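/- Let $N\ge 0$, $n_1,\dots,n_N\ge 0$ be integers and let $\mathcal U$ be a complex Hilbert space; $L(\cdot)$ denotes bounded linear operators. Put $$\Pi=\{Z=(Z_1,\dots,Z_N): Z_k\in\mathbb C^{n_k\times n_k},\ Z_k+Z_k^*>0\},\qquad \Omega=\bigcup_{|\lambda|=1}\lambda\Pi,$$ $$\mathbb D=\{W=(W_1,\dots,W_N): W_k\in\mathbb C^{n_k\times n_k},\ W_kW_k^*<I_{n_k}\}.$$ Let $\mathcal B_{n_1,\dots,n_N}(\mathcal U)$ be the class of holomorphic functions $f:\Omega\to L(\mathcal U)$ for which there are Hilbert spaces $\mathcal M_1,\dots,\mathcal M_N,\mathcal H$ and operators $G_k\in L(\mathcal U\oplus\mathcal H,\mathbb C^{n_k}\otimes\mathcal M_k)$ such that, with $$\sum_{k=1}^N G_k^*(Z_k\otimes I_{\mathcal M_k})G_k=\begin{bmatrix}a(Z)&b(Z)\\ c(Z)&d(Z)\end{bmatrix}\in L(\mathcal U\oplus\mathcal H),$$ the operator $d(Z)$ is boundedly invertible and $f(Z)=a(Z)-b(Z)d(Z)^{-1}c(Z)$ for all $Z\in\Omega$.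 For $f$ in this class, the double Cayley transform of $f$ is the function on $\mathbb D$ $$\mathcal C(f)(W)=(f(Z)-I_{\mathcal U})(f(Z)+I_{\mathcal U})^{-1},\qquad Z_k=(I_{n_k}+W_k)(I_{n_k}-W_k)^{-1}.$$ Then $\mathcal C(f)$ is well defined for every $f\in\mathcal B_{n_1,\dots,n_N}(\mathcal U)$, that is, $f(Z)+I_{\mathcal U}$ is boundedly invertible for all $W\in\mathbb D$. Moreover, a holomorphic function $F:\mathbb D\to L(\mathcal U)$ satisfies $F=\mathcal C(f)$ on $\mathbb D$ for some $f\in\mathcal B_{n_1,\dots,n_N}(\mathcal U)$ if and only if the following two conditions hold. (i) There exist a Hilbert space $\mathcal X$ and an operator $$U=\begin{bmatrix}A&B\\ C&D\end{bmatrix}\in L\bigl((\mathbb C^{n_1+\cdots+n_N}\otimes\mathcal X)\oplus\mathcal U\bigr),\qquad U=U^*=U^{-1},$$ such that for all $W\in\mathbb D$, with $P(W)=\mathrm{diag}(W_1,\dots,W_N)$, the operator $I-A(P(W)\otimes I_{\mathcal X})$ is boundedly invertible and $$F(W)=D+C(P(W)\otimes I_{\mathcal X})\bigl(I-A(P(W)\otimes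 I_{\mathcal X})\bigr)^{-1}B.$$ (ii) $1\notin\sigma(F(0))$. -/

import Mathlib

open scoped TensorProduct ComplexOrder

universe u v

noncomputable section

namespace Bessmertnyi

/-- The algebraic tensor product `ℂ^ι ⊗ M` (with its Hilbert inner product) of a finite-dimensional
space and a Hilbert space `M` is already complete, hence is the Hilbert space tensor product. -/
instance completeSpace_tensor (ι : Type v) [Fintype ι] (M : Type u) [NormedAddCommGroup M]
    [InnerProductSpace ℂ M] [CompleteSpace M] :
    CompleteSpace (EuclideanSpace ℂ ι ⊗[ℂ] M) := by
  classical
  let c : (EuclideanSpace ℂ ι ⊗[ℂ] M) →L[ℂ] (ι → M) :=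
    ContinuousLinearMap.pi fun i =>
      (TensorProduct.lidIsometry ℂ M).toContinuousLinearEquiv.toContinuousLinearMap ∘L
        (EuclideanSpace.proj i : EuclideanSpace ℂ ι →L[ℂ] ℂ).rTensor M
  let d : (ι → M) →L[ℂ] (EuclideanSpace ℂ ι ⊗[ℂ] M) :=
    ∑ i, (TensorProduct.mkL ℂ (EuclideanSpace ℂ ι) M (EuclideanSpace.single i 1)) ∘L
      ContinuousLinearMap.proj i
  have h1 : ∀ x, d (c x) = x := by
    intro x
    induction x with
    | zero => simp
    | add x y hx hy => rw [map_add, map_add, hx, hy]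
    | tmul e m =>
      have he : e = ∑ i, e i • EuclideanSpace.single i (1 : ℂ) := by
        ext j
        simp [Finset.sum_apply, Pi.single_apply]
      conv_rhs => rw [he, TensorProduct.sum_tmul]
      simp [d, c, TensorProduct.smul_tmul]
  have h2 : ∀ y, c (d y) = y := by
    intro y
    ext i
    simp [d, c]
  let e : (EuclideanSpace ℂ ι ⊗[ℂ] M) ≃L[ℂ] (ι → M) := ContinuousLinearEquiv.equivOfInverse c d h1 h2
  exact (completeSpace_congr (e := e.toEquiv) e.isUniformEmbedding).2 inferInstance

section Blocks

variable {E F : Type*} [NormedAddCommGroup E] [InnerProductSpace ℂ E]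
  [NormedAddCommGroup F] [InnerProductSpace ℂ F]

/-- The embedding of `E` in the orthogonal direct sum `E ⊕ F = WithLp 2 (E × F)`. -/
def inlL (E F : Type*) [NormedAddCommGroup E] [InnerProductSpace ℂ E]
    [NormedAddCommGroup F] [InnerProductSpace ℂ F] : E →L[ℂ] WithLp 2 (E × F) :=
  (WithLp.prodContinuousLinearEquiv 2 ℂ E F).symm.toContinuousLinearMap ∘L
    ContinuousLinearMap.inl ℂ E F

/-- The embedding of `F` in the orthogonal direct sum `E ⊕ F`. -/
def inrL (E F : Type*) [NormedAddCommGroup E] [InnerProductSpace ℂ E]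
    [NormedAddCommGroup F] [InnerProductSpace ℂ F] : F →L[ℂ] WithLp 2 (E × F) :=
  (WithLp.prodContinuousLinearEquiv 2 ℂ E F).symm.toContinuousLinearMap ∘L
    ContinuousLinearMap.inr ℂ E F

/-- The upper left block of an operator on `E ⊕ F`. -/
def block11 (T : WithLp 2 (E × F) →L[ℂ] WithLp 2 (E × F)) : E →L[ℂ] E :=
  WithLp.fstL 2 ℂ E F ∘L T ∘L inlL E F

/-- The upper right block of an operator on `E ⊕ F`. -/
def block12 (T : WithLp 2 (E × F) →L[ℂ] WithLp 2 (E × F)) : F →L[ℂ] E :=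
  WithLp.fstL 2 ℂ E F ∘L T ∘L inrL E F

/-- The lower left block of an operator on `E ⊕ F`. -/
def block21 (T : WithLp 2 (E × F) →L[ℂ] WithLp 2 (E × F)) : E →L[ℂ] F :=
  WithLp.sndL 2 ℂ E F ∘L T ∘L inlL E F

/-- The lower right block of an operator on `E ⊕ F`. -/
def block22 (T : WithLp 2 (E × F) →L[ℂ] WithLp 2 (E × F)) : F →L[ℂ] F :=
  WithLp.sndL 2 ℂ E F ∘L T ∘L inrL E F

end Blocks

/-- The operator `Z ⊗ I_M` on `ℂ^ι ⊗ M`. -/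
def tensorId {ι : Type v} [Fintype ι] [DecidableEq ι] (Z : Matrix ι ι ℂ) (M : Type u)
    [NormedAddCommGroup M] [InnerProductSpace ℂ M] :
    (EuclideanSpace ℂ ι ⊗[ℂ] M) →L[ℂ] (EuclideanSpace ℂ ι ⊗[ℂ] M) :=
  (Matrix.toEuclideanCLM (n := ι) (𝕜 := ℂ) Z).rTensor M

/-- Tuples `(Z_1, …, Z_N)` of complex matrices, `Z_k` of size `n_k × n_k`. -/
abbrev MatTuple {N : ℕ} (n : Fin N → ℕ) : Type :=
  ∀ k, Matrix (Fin (n k)) (Fin (n k)) ℂ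

/-- The product of the open right matrix halfplanes `Z_k + Z_k^* > 0`. -/
def halfplane {N : ℕ} (n : Fin N → ℕ) : Set (MatTuple n) :=
  {Z | ∀ k, (Z k + (Z k).conjTranspose).PosDef}

/-- The domain `⋃_{|λ| = 1} λ Π`, where `Π` is the product of the matrix halfplanes. -/
def omega {N : ℕ} (n : Fin N → ℕ) : Set (MatTuple n) :=
  {Z | ∃ l : ℂ, ‖l‖ = 1 ∧ ∃ Y ∈ halfplane n, Z = l • Y}

/-- The product of the open matrix unit disks `W_k W_k^* < I`. -/
def disk {N : ℕ} (n : Fin N → ℕ) : Set (MatTuple n) :=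
  {W | ∀ k, (1 - W k * (W k).conjTranspose).PosDef}

/-- The linear pencil `A(Z) = ∑_k G_k^* (Z_k ⊗ I_{M_k}) G_k` on `𝒰 ⊕ H`. -/
def pencil {N : ℕ} {n : Fin N → ℕ} {𝒰 H : Type u} {M : Fin N → Type u}
    [NormedAddCommGroup 𝒰] [InnerProductSpace ℂ 𝒰] [CompleteSpace 𝒰]
    [NormedAddCommGroup H] [InnerProductSpace ℂ H] [CompleteSpace H]
    [∀ k, NormedAddCommGroup (M k)] [∀ k, InnerProductSpace ℂ (M k)] [∀ k, CompleteSpace (M k)]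
    (G : ∀ k, WithLp 2 (𝒰 × H) →L[ℂ] (EuclideanSpace ℂ (Fin (n k)) ⊗[ℂ] M k)) (Z : MatTuple n) :
    WithLp 2 (𝒰 × H) →L[ℂ] WithLp 2 (𝒰 × H) :=
  ∑ k, ContinuousLinearMap.adjoint (G k) ∘L tensorId (Z k) (M k) ∘L G k

/-- The Bessmertnyĭ class: functions holomorphic on `omega n` (values elsewhere are irrelevant) of
the form `f(Z) = a(Z) - b(Z) d(Z)⁻¹ c(Z)`, where `a, b, c, d` are the blocks of a pencil
and `d(Z)` is boundedly invertible for all `Z` in `omega n`. -/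
def bessmertnyiClass {N : ℕ} (n : Fin N → ℕ) (𝒰 : Type u)
    [NormedAddCommGroup 𝒰] [InnerProductSpace ℂ 𝒰] [CompleteSpace 𝒰] :
    Set (MatTuple n → 𝒰 →L[ℂ] 𝒰) :=
  {f | DifferentiableOn ℂ f (omega n) ∧
    ∃ (M : Fin N → Type u) (_ : ∀ k, NormedAddCommGroup (M k))
      (_ : ∀ k, InnerProductSpace ℂ (M k)) (_ : ∀ k, CompleteSpace (M k))
      (H : Type u) (_ : NormedAddCommGroup H) (_ : InnerProductSpace ℂ H) (_ : CompleteSpace H)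
      (G : ∀ k, WithLp 2 (𝒰 × H) →L[ℂ] (EuclideanSpace ℂ (Fin (n k)) ⊗[ℂ] M k)),
      ∀ Z ∈ omega n, IsUnit (block22 (pencil G Z)) ∧
        f Z = block11 (pencil G Z) -
          block12 (pencil G Z) ∘L Ring.inverse (block22 (pencil G Z)) ∘L block21 (pencil G Z)}

/-- The Cayley transform over the variables, `Z_k = (I + W_k)(I - W_k)⁻¹`. -/
def cayley {N : ℕ} {n : Fin N → ℕ} (W : MatTuple n) : MatTuple n :=
  fun k => (1 + W k) * (1 - W k)⁻¹

/-- The double Cayley transform `W ↦ (f(Z) - I)(f(Z) + I)⁻¹`, `Z = cayley W`. -/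
def doubleCayley {N : ℕ} {n : Fin N → ℕ} {𝒰 : Type u}
    [NormedAddCommGroup 𝒰] [InnerProductSpace ℂ 𝒰] (f : MatTuple n → 𝒰 →L[ℂ] 𝒰)
    (W : MatTuple n) : 𝒰 →L[ℂ] 𝒰 :=
  (f (cayley W) - 1) * Ring.inverse (f (cayley W) + 1)

/-- The index set of `ℂ^{n_1 + ⋯ + n_N} = ⨁_k ℂ^{n_k}`. -/
abbrev Idx {N : ℕ} (n : Fin N → ℕ) : Type := Σ k : Fin N, Fin (n k)

/-- `F(W) = D + C (P(W) ⊗ I)(I - A (P(W) ⊗ I))⁻¹ B` on the product of matrix disks, where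
`P(W) = diag(W_1, …, W_N)` and `A, B, C, D` are the blocks of `T`. -/
def IsRealizedBy {N : ℕ} {n : Fin N → ℕ} {𝒰 X : Type u}
    [NormedAddCommGroup 𝒰] [InnerProductSpace ℂ 𝒰] [NormedAddCommGroup X] [InnerProductSpace ℂ X]
    (F : MatTuple n → 𝒰 →L[ℂ] 𝒰)
    (T : WithLp 2 ((EuclideanSpace ℂ (Idx n) ⊗[ℂ] X) × 𝒰) →L[ℂ]
      WithLp 2 ((EuclideanSpace ℂ (Idx n) ⊗[ℂ] X) × 𝒰)) : Prop :=
  ∀ W ∈ disk n,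
    IsUnit (1 - block11 T ∘L tensorId (Matrix.blockDiagonal' W) X) ∧
    F W = block22 T + block21 T ∘L tensorId (Matrix.blockDiagonal' W) X ∘L
      Ring.inverse (1 - block11 T ∘L tensorId (Matrix.blockDiagonal' W) X) ∘L block12 T

end Bessmertnyi

end

noncomputable section

namespace Bessmertnyi

open ContinuousLinearMap Matrix

/-! ### Positivity and the Cayley transform for matrices. -/

section Matrices

variable {ι : Type v} [Fintype ι] [DecidableEq ι]

/-! Both directions rest on one correspondence between operators `G : 𝒰 ⊕ H → K`, with `K =
ℂ^{n_1+⋯+n_N} ⊗ X`, and self-adjoint unitaries `T` on `K ⊕ 𝒰`: `T` is `-1` on the vectors `(-G(u,h),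
u)` and `1` on their orthogonal complement, which contains every `(v, y)` with `G^* v = (y, 0)`.

Write `f = a - b d⁻¹ c` for the pencil `G^* Z G`. Given `u`, choose `h` with `G^* Z G (u,h) = (f u,
0)` and put `x = G(u,h)`. Then `(-x, u)` and `(Zx, f u)` are eigenvectors for `-1` and `1`, so `T`
sends their sum `(Zx - x, f u + u)` to `(Zx + x, f u - u)`. Since `W(Zx + x) = Zx - x`, the transfer
function of `T` at `W` maps `(f + 1)u` to `(f - 1)u`: it is the double Cayley transform
(`transfer_eq_cayley_schur`).

From `f` to `T`, the `G_k` are glued into one `G` (`pencil_eq_adjoint_sum_comp`) and `T` is a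
reflection. From `T` to `f`, the realization gives `F(0) = D`, so condition (ii) makes `1 - D`
invertible, and this exhibits the `-1` eigenspace as a graph of the required shape
(`exists_graphOp_eigenspace`). Invertibility of `f + 1` and of `d(Z)` comes from coercivity on the
halfplane. -/

theorem exists_isUnit_conjTranspose_mul_self {Q : Matrix ι ι ℂ} (hQ : Q.PosDef) :
    ∃ S : Matrix ι ι ℂ, IsUnit S ∧ Q = Sᴴ * S := by
  open scoped MatrixOrder in
  obtain ⟨S, hS⟩ := CStarAlgebra.nonneg_iff_eq_star_mul_self.mp hQ.posSemidef.nonneg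
  refine ⟨S, ?_, hS⟩
  have h := hQ.isUnit
  rw [hS] at h
  rw [Matrix.isUnit_iff_isUnit_det, Matrix.det_mul] at h
  exact (Matrix.isUnit_iff_isUnit_det _).2 (isUnit_of_mul_isUnit_right h)

theorem posDef_blockDiagonal' {o : Type*} [Fintype o] [DecidableEq o] {m : o → Type*}
    [∀ i, Fintype (m i)] [∀ i, DecidableEq (m i)] {Q : ∀ i, Matrix (m i) (m i) ℂ}
    (hQ : ∀ i, (Q i).PosDef) : (Matrix.blockDiagonal' Q).PosDef := by
  choose S hS hQS using fun i => exists_isUnit_conjTranspose_mul_self (hQ i)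
  have h : Matrix.blockDiagonal' Q =
      (Matrix.blockDiagonal' S)ᴴ * Matrix.blockDiagonal' S := by
    rw [Matrix.blockDiagonal'_conjTranspose, ← Matrix.blockDiagonal'_mul]
    congr 1
    exact funext hQS
  have hps : (Matrix.blockDiagonal' Q).PosSemidef := by
    rw [h]
    exact Matrix.posSemidef_conjTranspose_mul_self _
  rw [hps.posDef_iff_isUnit]
  refine IsUnit.of_mul_eq_one (Matrix.blockDiagonal' fun i => (Q i)⁻¹) ?_
  rw [← Matrix.blockDiagonal'_mul, ← Matrix.blockDiagonal'_one]
  congr 1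
  funext i
  exact Matrix.mul_nonsing_inv _ ((Matrix.isUnit_iff_isUnit_det _).1 (hQ i).isUnit)

/-- A left null vector of `1 - W` is fixed by `W`, so the form of `1 - W Wᴴ` would vanish on it. -/
theorem isUnit_one_sub_of_posDef {W : Matrix ι ι ℂ} (hW : (1 - W * Wᴴ).PosDef) :
    IsUnit (1 - W) := by
  rw [Matrix.isUnit_iff_isUnit_det, isUnit_iff_ne_zero]
  intro h
  obtain ⟨v, hv, hvW⟩ := Matrix.exists_vecMul_eq_zero_iff.2 h
  rw [Matrix.vecMul_sub, Matrix.vecMul_one, sub_eq_zero] at hvW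
  have h1 := hW.dotProduct_mulVec_pos (x := star v) (by simpa using hv)
  rw [star_star, Matrix.dotProduct_mulVec, Matrix.vecMul_sub, Matrix.vecMul_one,
    ← Matrix.vecMul_vecMul, ← hvW, sub_dotProduct, ← Matrix.dotProduct_mulVec,
    ← Matrix.star_vecMul, ← hvW, sub_self] at h1
  exact lt_irrefl _ h1

theorem sub_mul_cayley {W : Matrix ι ι ℂ} (hW : IsUnit (1 - W)) :
    (1 + W) * (1 - W)⁻¹ - W * ((1 + W) * (1 - W)⁻¹) = 1 + W := by
  have h : (1 - W) * (1 - W)⁻¹ = 1 :=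
    Matrix.mul_nonsing_inv _ ((Matrix.isUnit_iff_isUnit_det _).1 hW)
  calc _ = (1 + W) * ((1 - W) * (1 - W)⁻¹) := by noncomm_ring
    _ = _ := by rw [h, mul_one]

/-- Congruence by the invertible `1 - W` turns `Z + Zᴴ` into `2(1 - W Wᴴ)`. -/
theorem posDef_cayley_add_conjTranspose {W : Matrix ι ι ℂ} (hW : (1 - W * Wᴴ).PosDef) :
    ((1 + W) * (1 - W)⁻¹ + ((1 + W) * (1 - W)⁻¹)ᴴ).PosDef := by
  have hu := isUnit_one_sub_of_posDef hW
  set Z := (1 + W) * (1 - W)⁻¹ with hZ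
  have h1 : (1 - W) * Z = 1 + W := by rw [sub_mul, one_mul]; exact sub_mul_cayley hu
  have h2 : (1 - W) * (Z + Zᴴ) * (1 - W)ᴴ = (1 - W * Wᴴ) + (1 - W * Wᴴ) := by
    have h3 : Zᴴ * (1 - W)ᴴ = 1 + Wᴴ := by
      rw [← Matrix.conjTranspose_mul, h1]; simp
    rw [mul_add, add_mul, h1, mul_assoc _ Zᴴ, h3]
    simp only [Matrix.conjTranspose_sub, Matrix.conjTranspose_one]
    noncomm_ring
  rw [← Matrix.IsUnit.posDef_star_right_conjugate_iff hu]
  rw [Matrix.star_eq_conjTranspose, h2]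
  exact hW.add hW

end Matrices

/-! ### Matrix tuples and their block diagonals. -/

section Tuples

variable {N : ℕ} {n : Fin N → ℕ}

theorem zero_mem_disk : (0 : MatTuple n) ∈ disk n := fun k => by
  simpa using Matrix.PosDef.one

theorem cayley_mem_halfplane {W : MatTuple n} (hW : W ∈ disk n) : cayley W ∈ halfplane n :=
  fun k => posDef_cayley_add_conjTranspose (hW k)

theorem halfplane_subset_omega : halfplane n ⊆ omega n := fun Z hZ =>
  ⟨1, by simp, Z, hZ, by simp⟩

theorem posDef_blockDiagonal'_add {Z : MatTuple n} (hZ : Z ∈ halfplane n) :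
    (Matrix.blockDiagonal' Z + (Matrix.blockDiagonal' Z)ᴴ).PosDef := by
  rw [Matrix.blockDiagonal'_conjTranspose, ← Matrix.blockDiagonal'_add]
  exact posDef_blockDiagonal' hZ

theorem posDef_one_sub_blockDiagonal' {W : MatTuple n} (hW : W ∈ disk n) :
    (1 - Matrix.blockDiagonal' W * (Matrix.blockDiagonal' W)ᴴ).PosDef := by
  rw [Matrix.blockDiagonal'_conjTranspose, ← Matrix.blockDiagonal'_mul,
    ← Matrix.blockDiagonal'_one, ← Matrix.blockDiagonal'_sub]
  exact posDef_blockDiagonal' hW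

theorem blockDiagonal'_cayley {W : MatTuple n} (hW : W ∈ disk n) :
    Matrix.blockDiagonal' (cayley W) - Matrix.blockDiagonal' W * Matrix.blockDiagonal' (cayley W) =
      1 + Matrix.blockDiagonal' W := by
  rw [← Matrix.blockDiagonal'_mul, ← Matrix.blockDiagonal'_one, ← Matrix.blockDiagonal'_sub,
    ← Matrix.blockDiagonal'_add]
  congr 1
  funext k
  exact sub_mul_cayley (isUnit_one_sub_of_posDef (hW k))

end Tuples

/-! ### Ampliations `Z ⊗ I`: coercivity and contractivity. -/

section TensorId

variable {ι : Type v} [Fintype ι] [DecidableEq ι] (M : Type u)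
  [NormedAddCommGroup M] [InnerProductSpace ℂ M]

theorem tensorId_add (Z Y : Matrix ι ι ℂ) :
    tensorId (Z + Y) M = tensorId Z M + tensorId Y M := by
  simp [tensorId]

theorem tensorId_sub (Z Y : Matrix ι ι ℂ) :
    tensorId (Z - Y) M = tensorId Z M - tensorId Y M := by
  simp [tensorId]

theorem tensorId_smul (c : ℂ) (Z : Matrix ι ι ℂ) :
    tensorId (c • Z) M = c • tensorId Z M := by
  simp [tensorId]

theorem tensorId_zero : tensorId (0 : Matrix ι ι ℂ) M = 0 := by
  simp [tensorId]

theorem tensorId_one : tensorId (1 : Matrix ι ι ℂ) M = 1 := by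
  simp [tensorId]

theorem tensorId_mul (Z Y : Matrix ι ι ℂ) :
    tensorId (Z * Y) M = tensorId Z M * tensorId Y M := by
  simp only [tensorId, map_mul, rTensor_mul]

theorem tensorId_conjTranspose [CompleteSpace M] (Z : Matrix ι ι ℂ) :
    tensorId Zᴴ M = adjoint (tensorId Z M) := by
  rw [tensorId, tensorId, adjoint_rTensor, ← Matrix.star_eq_conjTranspose, map_star]
  rfl

variable [CompleteSpace M]

/-- With `Q = Sᴴ S`, the form is `‖(S ⊗ I)x‖²`, bounded below because `S⁻¹ ⊗ I` is bounded. -/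
theorem exists_pos_le_re_inner_tensorId {Q : Matrix ι ι ℂ} (hQ : Q.PosDef) :
    ∃ δ : ℝ, 0 < δ ∧ ∀ x, δ * ‖x‖ ^ 2 ≤ (inner ℂ (tensorId Q M x) x).re := by
  obtain ⟨S, hS, rfl⟩ := exists_isUnit_conjTranspose_mul_self hQ
  -- The added `1` keeps `c` positive even on the zero space.
  set c := ‖tensorId S⁻¹ M‖ + 1 with hc
  have hc0 : 0 < c := by positivity
  refine ⟨(c ^ 2)⁻¹, by positivity, fun x => ?_⟩
  have h1 : tensorId S⁻¹ M (tensorId S M x) = x := by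
    rw [← mul_apply_eq_comp, ← tensorId_mul,
      Matrix.nonsing_inv_mul _ ((Matrix.isUnit_iff_isUnit_det _).1 hS), tensorId_one]
    rfl
  have h2 : ‖x‖ ≤ c * ‖tensorId S M x‖ := by
    calc ‖x‖ = ‖tensorId S⁻¹ M (tensorId S M x)‖ := by rw [h1]
      _ ≤ ‖tensorId S⁻¹ M‖ * ‖tensorId S M x‖ := le_opNorm _ _
      _ ≤ _ := by gcongr; simp [hc]
  have h3 : (inner ℂ (tensorId (Sᴴ * S) M x) x).re = ‖tensorId S M x‖ ^ 2 := by
    rw [tensorId_mul, tensorId_conjTranspose, mul_apply_eq_comp, adjoint_inner_left]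
    exact inner_self_eq_norm_sq (𝕜 := ℂ) _
  rw [h3, inv_mul_le_iff₀ (by positivity), ← mul_pow]
  gcongr

theorem exists_pos_le_re_inner_tensorId_of_add {Z : Matrix ι ι ℂ} (hZ : (Z + Zᴴ).PosDef) :
    ∃ δ : ℝ, 0 < δ ∧ ∀ x, δ * ‖x‖ ^ 2 ≤ (inner ℂ (tensorId Z M x) x).re := by
  obtain ⟨δ, hδ, h⟩ := exists_pos_le_re_inner_tensorId M hZ
  refine ⟨δ / 2, by positivity, fun x => ?_⟩
  have h1 := h x
  rw [tensorId_add, tensorId_conjTranspose, _root_.add_apply, inner_add_left, adjoint_inner_left,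
    Complex.add_re] at h1
  have h2 : (inner ℂ x (tensorId Z M x)).re = (inner ℂ (tensorId Z M x) x).re :=
    inner_re_symm (𝕜 := ℂ) x (tensorId Z M x)
  rw [h2] at h1
  linarith

theorem norm_tensorId_lt_one {W : Matrix ι ι ℂ} (hW : (1 - W * Wᴴ).PosDef) :
    ‖tensorId W M‖ < 1 := by
  obtain ⟨δ, hδ, h⟩ := exists_pos_le_re_inner_tensorId M hW
  have h1 : ∀ x, ‖tensorId Wᴴ M x‖ ^ 2 ≤ (1 - δ) * ‖x‖ ^ 2 := fun x => by
    have h2 := h x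
    have h3 : (inner ℂ x x).re = ‖x‖ ^ 2 := inner_self_eq_norm_sq (𝕜 := ℂ) x
    have h4 : (inner ℂ (tensorId (W * Wᴴ) M x) x).re = ‖tensorId Wᴴ M x‖ ^ 2 := by
      rw [tensorId_mul, mul_apply_eq_comp, ← adjoint_inner_right,
        ← tensorId_conjTranspose]
      exact inner_self_eq_norm_sq (𝕜 := ℂ) _
    rw [tensorId_sub, tensorId_one, _root_.sub_apply, one_apply_eq_self, inner_sub_left, Complex.sub_re,
      h3, h4] at h2
    linarith
  -- On the zero space `δ` may exceed `1`, hence the truncation at `0`.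
  have h2 : ‖tensorId Wᴴ M‖ ≤ √(max (1 - δ) 0) := by
    refine opNorm_le_bound _ (by positivity) fun x => ?_
    refine le_of_sq_le_sq ?_ (by positivity)
    rw [mul_pow, Real.sq_sqrt (by positivity)]
    exact (h1 x).trans (by gcongr; exact le_max_left _ _)
  rw [tensorId_conjTranspose, LinearIsometryEquiv.norm_map] at h2
  refine h2.trans_lt ?_
  rw [Real.sqrt_lt' one_pos]
  simp [hδ]

end TensorId

end Bessmertnyi

end

noncomputable section

namespace Bessmertnyi

open ContinuousLinearMap

/-! ### Schur complements and transfer functions. -/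

section Operators

variable {E F K 𝒰 H : Type*} [NormedAddCommGroup E] [InnerProductSpace ℂ E]
  [NormedAddCommGroup F] [InnerProductSpace ℂ F] [NormedAddCommGroup K] [InnerProductSpace ℂ K]
  [NormedAddCommGroup 𝒰] [InnerProductSpace ℂ 𝒰] [NormedAddCommGroup H] [InnerProductSpace ℂ H]

theorem isUnit_of_le_re_inner [CompleteSpace E] (T : E →L[ℂ] E) {δ : ℝ} (hδ : 0 < δ)
    (h : ∀ x, δ * ‖x‖ ^ 2 ≤ (inner ℂ (T x) x).re) : IsUnit T := by
  refine isUnit_of_forall_le_norm_inner_map T (c := ⟨δ, hδ.le⟩) hδ fun x => ?_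
  rw [mul_comm]
  exact (h x).trans (Complex.re_le_norm _)

theorem inverse_apply_apply {T : E →L[ℂ] E} (hT : IsUnit T) (x : E) :
    Ring.inverse T (T x) = x := by
  rw [← mul_apply_eq_comp, Ring.inverse_mul_cancel _ hT]
  rfl

theorem apply_inverse_apply {T : E →L[ℂ] E} (hT : IsUnit T) (x : E) :
    T (Ring.inverse T x) = x := by
  rw [← mul_apply_eq_comp, Ring.mul_inverse_cancel _ hT]
  rfl

theorem inlL_apply (x : E) : inlL E F x = WithLp.toLp 2 (x, 0) := rfl

theorem inrL_apply (y : F) : inrL E F y = WithLp.toLp 2 (0, y) := rfl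

theorem apply_toLp_eq (T : WithLp 2 (E × F) →L[ℂ] WithLp 2 (E × F)) (x : E) (y : F) :
    T (WithLp.toLp 2 (x, y)) =
      WithLp.toLp 2 (block11 T x + block12 T y, block21 T x + block22 T y) := by
  have h : WithLp.toLp 2 (x, y) = inlL E F x + inrL E F y := by
    rw [inlL_apply, inrL_apply, ← WithLp.toLp_add]
    simp
  rw [h, map_add]
  rfl

theorem norm_block11_le (T : WithLp 2 (E × F) →L[ℂ] WithLp 2 (E × F)) {c : ℝ} (hc : 0 ≤ c)
    (h : ∀ x, ‖T x‖ ≤ c * ‖x‖) : ‖block11 T‖ ≤ c := by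
  refine opNorm_le_bound _ hc fun x => ?_
  have h1 : block11 T x = (T (inlL E F x)).fst := rfl
  rw [h1]
  refine (WithLp.norm_fst_le _ _).trans ((h _).trans_eq ?_)
  rw [inlL_apply]
  simp

/-- The Schur complement `a - b d⁻¹ c` of the lower right block. -/
def schur (S : WithLp 2 (E × F) →L[ℂ] WithLp 2 (E × F)) : E →L[ℂ] E :=
  block11 S - block12 S ∘L Ring.inverse (block22 S) ∘L block21 S

theorem exists_apply_eq_schur {S : WithLp 2 (E × F) →L[ℂ] WithLp 2 (E × F)}
    (hS : IsUnit (block22 S)) (u : E) :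
    ∃ h : F, S (WithLp.toLp 2 (u, h)) = WithLp.toLp 2 (schur S u, 0) := by
  refine ⟨-Ring.inverse (block22 S) (block21 S u), ?_⟩
  rw [apply_toLp_eq, map_neg, map_neg, apply_inverse_apply hS, add_neg_cancel]
  simp [schur, sub_eq_add_neg]

/-- Since `S(u,h) = (schur S u, 0)` for a suitable `h`, the Schur complement inherits a nonnegative
real part, and adding `1` makes it coercive. -/
theorem isUnit_schur_add_one [CompleteSpace E] {S : WithLp 2 (E × F) →L[ℂ] WithLp 2 (E × F)}
    (hS : IsUnit (block22 S)) (hre : ∀ x, 0 ≤ (inner ℂ (S x) x).re) : IsUnit (schur S + 1) := by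
  refine isUnit_of_le_re_inner _ one_pos fun u => ?_
  obtain ⟨h, hh⟩ := exists_apply_eq_schur hS u
  have h1 := hre (WithLp.toLp 2 (u, h))
  rw [hh, WithLp.prod_inner_apply] at h1
  have h2 : (inner ℂ u u).re = ‖u‖ ^ 2 := inner_self_eq_norm_sq (𝕜 := ℂ) u
  rw [_root_.add_apply, one_apply_eq_self, inner_add_left, Complex.add_re, h2, one_mul]
  simpa using h1

/-- The graph-like operator `(u, h) ↦ (-G(u, h), u)`, whose range is the `-1` eigenspace of the
self-adjoint unitary colligation attached to `G`. -/
def graphOp (G : WithLp 2 (𝒰 × H) →L[ℂ] K) : WithLp 2 (𝒰 × H) →L[ℂ] WithLp 2 (K × 𝒰) :=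
  inrL K 𝒰 ∘L WithLp.fstL 2 ℂ 𝒰 H - inlL K 𝒰 ∘L G

theorem graphOp_apply (G : WithLp 2 (𝒰 × H) →L[ℂ] K) (x : WithLp 2 (𝒰 × H)) :
    graphOp G x = WithLp.toLp 2 (-G x, x.fst) := by
  have h : graphOp G x = inrL K 𝒰 x.fst - inlL K 𝒰 (G x) := rfl
  rw [h, inlL_apply, inrL_apply, ← WithLp.toLp_sub]
  simp

theorem mem_orthogonal_range_graphOp [CompleteSpace K] [CompleteSpace 𝒰] [CompleteSpace H]
    {G : WithLp 2 (𝒰 × H) →L[ℂ] K} {v : K} {y : 𝒰} (h : adjoint G v = WithLp.toLp 2 (y, 0)) :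
    WithLp.toLp 2 (v, y) ∈ (graphOp G).rangeᗮ := by
  rw [Submodule.mem_orthogonal]
  rintro _ ⟨x, rfl⟩
  have h1 : inner ℂ (G x) v = inner ℂ x.fst y := by
    rw [← adjoint_inner_right, h, WithLp.prod_inner_apply]
    simp
  change inner ℂ (graphOp G x) _ = 0
  rw [graphOp_apply, WithLp.prod_inner_apply]
  simp [h1]

/-- The first row of the system reads `(1 - A W)s = B e`, so invertibility determines the state `s`;
the second row is then the output. -/
theorem transfer_apply {T : WithLp 2 (K × 𝒰) →L[ℂ] WithLp 2 (K × 𝒰)} {W : K →L[ℂ] K}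
    (hA : IsUnit (1 - block11 T ∘L W)) {s : K} {e φ : 𝒰}
    (h : T (WithLp.toLp 2 (W s, e)) = WithLp.toLp 2 (s, φ)) :
    (block22 T + block21 T ∘L W ∘L Ring.inverse (1 - block11 T ∘L W) ∘L block12 T) e = φ := by
  rw [apply_toLp_eq] at h
  have h1 : block11 T (W s) + block12 T e = s := congrArg WithLp.fst h
  have h2 : block21 T (W s) + block22 T e = φ := congrArg WithLp.snd h
  have h3 : block12 T e = (1 - block11 T ∘L W) s := by
    rw [_root_.sub_apply, one_apply_eq_self, comp_apply]
    exact eq_sub_of_add_eq' h1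
  simp only [_root_.add_apply, comp_apply, h3]
  rw [inverse_apply_apply hA, add_comm]
  exact h2

/-- The Cayley transform of the Schur complement of `G^* Z G` is the transfer function of
the reflection attached to `G`. -/
theorem transfer_eq_cayley_schur [CompleteSpace K] [CompleteSpace 𝒰] [CompleteSpace H]
    {T : WithLp 2 (K × 𝒰) →L[ℂ] WithLp 2 (K × 𝒰)} {G : WithLp 2 (𝒰 × H) →L[ℂ] K}
    (hneg : ∀ x, T (graphOp G x) = -graphOp G x) (hpos : ∀ z ∈ (graphOp G).rangeᗮ, T z = z)
    {Z W : K →L[ℂ] K} (hZW : Z - W * Z = 1 + W) (hA : IsUnit (1 - block11 T ∘L W))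
    (hd : IsUnit (block22 (adjoint G ∘L Z ∘L G)))
    (hs : IsUnit (schur (adjoint G ∘L Z ∘L G) + 1)) :
    block22 T + block21 T ∘L W ∘L Ring.inverse (1 - block11 T ∘L W) ∘L block12 T =
      (schur (adjoint G ∘L Z ∘L G) - 1) * Ring.inverse (schur (adjoint G ∘L Z ∘L G) + 1) := by
  ext e
  set f := schur (adjoint G ∘L Z ∘L G) with hf
  set u := Ring.inverse (f + 1) e with hu
  have he : f u + u = e := apply_inverse_apply hs e
  obtain ⟨h, hh⟩ := exists_apply_eq_schur hd u
  rw [← hf] at hh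
  set x := G (WithLp.toLp 2 (u, h)) with hx
  -- The two eigenvectors of `T` attached to `u`, for the eigenvalues `-1` and `1`.
  have hm : T (WithLp.toLp 2 (-x, u)) = -WithLp.toLp 2 (-x, u) := by
    have := hneg (WithLp.toLp 2 (u, h))
    rwa [graphOp_apply] at this
  have hp : T (WithLp.toLp 2 (Z x, f u)) = WithLp.toLp 2 (Z x, f u) :=
    hpos _ (mem_orthogonal_range_graphOp hh)
  have hW : W (Z x + x) = Z x - x := by
    have h1 := congrArg (fun L : K →L[ℂ] K => L x) hZW
    simp only [_root_.sub_apply, _root_.add_apply, mul_apply_eq_comp, one_apply_eq_self] at h1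
    rw [map_add, eq_sub_iff_add_eq, add_assoc, add_comm (W x) x, ← h1]
    abel
  rw [transfer_apply (s := Z x + x) (φ := f u - u) hA]
  · simp [← hu]
  · have h1 : WithLp.toLp 2 (W (Z x + x), e) =
        WithLp.toLp 2 (Z x, f u) + WithLp.toLp 2 (-x, u) := by
      rw [hW, ← he, ← WithLp.toLp_add, Prod.mk_add_mk, sub_eq_add_neg]
    rw [h1, map_add, hm, hp, ← sub_eq_add_neg, ← WithLp.toLp_sub, Prod.mk_sub_mk, sub_neg_eq_add]

end Operators

/-! ### Self-adjoint unitaries and their eigenspaces. -/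

section Colligation

variable {K 𝒰 : Type*} [NormedAddCommGroup K] [InnerProductSpace ℂ K]
  [NormedAddCommGroup 𝒰] [InnerProductSpace ℂ 𝒰]

/-- Reflecting in the orthogonal complement avoids asking that the range be closed: the complement
always is, and the range lies in its double complement. -/
theorem exists_reflection_graphOp [CompleteSpace K] [CompleteSpace 𝒰] {H : Type*} [NormedAddCommGroup H] [InnerProductSpace ℂ H]
    (G : WithLp 2 (𝒰 × H) →L[ℂ] K) :
    ∃ T : WithLp 2 (K × 𝒰) →L[ℂ] WithLp 2 (K × 𝒰), adjoint T = T ∧ T * T = 1 ∧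
      (∀ x, T (graphOp G x) = -graphOp G x) ∧ (∀ z ∈ (graphOp G).rangeᗮ, T z = z) ∧
      ∀ z, ‖T z‖ = ‖z‖ := by
  set L := (graphOp G).rangeᗮ with hL
  have : CompleteSpace L := (graphOp G).range.isClosed_orthogonal.completeSpace_coe
  have : L.HasOrthogonalProjection := .ofCompleteSpace L
  let T : WithLp 2 (K × 𝒰) →L[ℂ] WithLp 2 (K × 𝒰) :=
    L.reflection.toContinuousLinearEquiv.toContinuousLinearMap
  have hT : ∀ z, T z = L.reflection z := fun _ => rfl
  have hTT : ∀ z, T (T z) = z := fun z => L.reflection_reflection z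
  have hin : ∀ x y, inner ℂ (T x) (T y) = inner ℂ x y := fun x y =>
    L.reflection.inner_map_map x y
  refine ⟨T, ?_, ContinuousLinearMap.ext hTT, fun x => ?_, fun z hz => ?_,
    L.reflection.norm_map⟩
  · symm
    rw [eq_adjoint_iff]
    intro x y
    rw [← hin x (T y), hTT]
  · exact Submodule.reflection_mem_subspace_orthogonalComplement_eq_neg
      ((graphOp G).range.le_orthogonal_orthogonal ⟨x, rfl⟩)
  · exact Submodule.reflection_mem_subspace_eq_self hz

variable (T : WithLp 2 (K × 𝒰) →L[ℂ] WithLp 2 (K × 𝒰))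

/-- The vectors `x` with `T (x, 0) = -(x, 0)`. -/
def innerSpace : Submodule ℂ K := ((T + 1) ∘L inlL K 𝒰).ker

theorem mem_innerSpace {x : K} :
    x ∈ innerSpace T ↔ T (WithLp.toLp 2 (x, 0)) = -WithLp.toLp 2 (x, 0) := by
  rw [eq_neg_iff_add_eq_zero]
  rfl

instance completeSpace_innerSpace [CompleteSpace K] : CompleteSpace (innerSpace T) :=
  ((T + 1) ∘L inlL K 𝒰).isClosed_ker.completeSpace_coe

/-- The operator `(u, h) ↦ B (1 - D)⁻¹ u + h`, whose `graphOp` parametrizes the `-1` eigenspace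
of `T`. -/
def colligationOp : WithLp 2 (𝒰 × innerSpace T) →L[ℂ] K :=
  block12 T ∘L Ring.inverse (1 - block22 T) ∘L WithLp.fstL 2 ℂ 𝒰 (innerSpace T) +
    (innerSpace T).subtypeL ∘L WithLp.sndL 2 ℂ 𝒰 (innerSpace T)

theorem colligationOp_apply (u : 𝒰) (h : innerSpace T) :
    colligationOp T (WithLp.toLp 2 (u, h)) = block12 T (Ring.inverse (1 - block22 T) u) + h := rfl

variable {T}

/-- For an involution, `1 - T` maps into the `-1` eigenspace. With `w = (1 - D)⁻¹u`, the vector `(1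
- T)(0, w)` is `(-Bw, u)`, which explains the choice of `colligationOp`. -/
theorem apply_graphOp_colligationOp (hTT : T * T = 1) (hD : IsUnit (1 - block22 T))
    (x : WithLp 2 (𝒰 × innerSpace T)) :
    T (graphOp (colligationOp T) x) = -graphOp (colligationOp T) x := by
  obtain ⟨⟨u, h⟩, rfl⟩ := (WithLp.toLp_surjective 2) x
  have hTT' : ∀ z, T (T z) = z := fun z => congrArg (fun L : _ →L[ℂ] _ => L z) hTT
  set w := Ring.inverse (1 - block22 T) u with hw
  have hu : w - block22 T w = u := apply_inverse_apply hD u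
  have h1 : graphOp (colligationOp T) (WithLp.toLp 2 (u, h)) =
      WithLp.toLp 2 (0, w) - T (WithLp.toLp 2 (0, w)) - WithLp.toLp 2 ((h : K), 0) := by
    rw [graphOp_apply, colligationOp_apply, apply_toLp_eq, ← WithLp.toLp_sub, ← WithLp.toLp_sub,
      ← hw, map_zero, map_zero, zero_add, zero_add, Prod.mk_sub_mk, Prod.mk_sub_mk, hu]
    simp [sub_eq_add_neg, add_comm]
  rw [h1, map_sub, map_sub, hTT', (mem_innerSpace T).1 h.2]
  abel

theorem apply_eq_of_mem_orthogonal_range_graphOp_colligationOp [CompleteSpace K] [CompleteSpace 𝒰]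
    (hT : adjoint T = T) (hTT : T * T = 1) (hD : IsUnit (1 - block22 T)) {z : WithLp 2 (K × 𝒰)}
    (hz : z ∈ (graphOp (colligationOp T)).rangeᗮ) : T z = z := by
  have hTT' : ∀ z, T (T z) = z := fun z => congrArg (fun L : _ →L[ℂ] _ => L z) hTT
  -- The range contains a `-1` eigenvector `y₀` with the same `𝒰`-component as `y`; the difference
  -- has zero `𝒰`-component, so it comes from `innerSpace T`.
  have key : ∀ y, T y = -y → y ∈ (graphOp (colligationOp T)).range := fun y hy => by
    set y₀ := graphOp (colligationOp T) (WithLp.toLp 2 (y.snd, 0)) with hy₀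
    have h0 : T y₀ = -y₀ := apply_graphOp_colligationOp hTT hD _
    have h1 : y₀ - y = WithLp.toLp 2 (y₀.fst - y.fst, 0) := by
      apply (WithLp.equiv 2 _).injective
      refine Prod.ext rfl ?_
      change y₀.snd - y.snd = 0
      rw [hy₀, graphOp_apply]
      exact sub_self _
    have h2 : y₀.fst - y.fst ∈ innerSpace T := by
      rw [mem_innerSpace, ← h1, map_sub, h0, hy]
      abel
    have h3 : graphOp (colligationOp T) (WithLp.toLp 2 (0, ⟨_, h2⟩)) = -(y₀ - y) := by
      rw [graphOp_apply, colligationOp_apply, map_zero, map_zero, zero_add, h1]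
      simp [← WithLp.toLp_neg]
    refine ⟨WithLp.toLp 2 (y.snd, 0) + WithLp.toLp 2 (0, ⟨_, h2⟩), ?_⟩
    change graphOp (colligationOp T) _ = y
    rw [map_add, h3, ← hy₀]
    abel
  -- `z - T z` is a `-1` eigenvector, so it is orthogonal to `z` by `key`, and to `T z` by
  -- self-adjointness.
  have h1 : inner ℂ (z - T z) (z - T z) = 0 := by
    have h2 := (Submodule.mem_orthogonal _ _).1 hz (z - T z)
      (key _ (by rw [map_sub, hTT']; abel))
    have h3 : inner ℂ (z - T z) (T z) = -inner ℂ (z - T z) z := by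
      rw [← adjoint_inner_left, hT, map_sub, hTT', ← inner_neg_left]
      congr 1
      abel
    rw [inner_sub_right, h3, h2]
    simp
  exact (sub_eq_zero.1 (inner_self_eq_zero.1 h1)).symm

/-- The `-1` eigenspace of a self-adjoint unitary operator with `1 - D` invertible is the range of
a `graphOp`. -/
theorem exists_graphOp_eigenspace {K 𝒰 : Type u} [NormedAddCommGroup K] [InnerProductSpace ℂ K]
    [NormedAddCommGroup 𝒰] [InnerProductSpace ℂ 𝒰] [CompleteSpace K] [CompleteSpace 𝒰]
    {T : WithLp 2 (K × 𝒰) →L[ℂ] WithLp 2 (K × 𝒰)}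
    (hT : adjoint T = T) (hTT : T * T = 1) (hD : IsUnit (1 - block22 T)) :
    ∃ (H : Type u) (_ : NormedAddCommGroup H) (_ : InnerProductSpace ℂ H) (_ : CompleteSpace H)
      (G : WithLp 2 (𝒰 × H) →L[ℂ] K), (∀ h, ‖G (inrL 𝒰 H h)‖ = ‖h‖) ∧
      (∀ x, T (graphOp G x) = -graphOp G x) ∧ ∀ z ∈ (graphOp G).rangeᗮ, T z = z := by
  refine ⟨innerSpace T, inferInstance, inferInstance, inferInstance, colligationOp T, fun h => ?_,
    apply_graphOp_colligationOp hTT hD,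
    fun z => apply_eq_of_mem_orthogonal_range_graphOp_colligationOp hT hTT hD⟩
  rw [inrL_apply, colligationOp_apply, map_zero, map_zero, zero_add, Submodule.norm_coe]

end Colligation

end Bessmertnyi

end

noncomputable section

namespace Bessmertnyi

open ContinuousLinearMap

/-! ### Splitting `ℂ^{n_1+⋯+n_N}` into its summands. -/

section Coordinates

variable {N : ℕ} {n : Fin N → ℕ}

/-- The projection of `ℂ^{n_1 + ⋯ + n_N}` onto its `k`-th summand `ℂ^{n_k}`. -/
def projBlock (n : Fin N → ℕ) (k : Fin N) :
    EuclideanSpace ℂ (Idx n) →L[ℂ] EuclideanSpace ℂ (Fin (n k)) :=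
  LinearMap.toContinuousLinearMap
    { toFun := fun x => WithLp.toLp 2 fun i => x ⟨k, i⟩
      map_add' := fun _ _ => rfl
      map_smul' := fun _ _ => rfl }

theorem projBlock_apply (k : Fin N) (x : EuclideanSpace ℂ (Idx n)) (i : Fin (n k)) :
    projBlock n k x i = x ⟨k, i⟩ := rfl

theorem adjoint_projBlock_single (k : Fin N) (i : Fin (n k)) :
    adjoint (projBlock n k) (EuclideanSpace.single i 1) = EuclideanSpace.single ⟨k, i⟩ 1 := by
  refine ext_inner_right ℂ fun x => ?_
  rw [adjoint_inner_left, EuclideanSpace.inner_single_left, EuclideanSpace.inner_single_left,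
    projBlock_apply]

theorem projBlock_comp_adjoint (k : Fin N) : projBlock n k ∘L adjoint (projBlock n k) = 1 := by
  refine ContinuousLinearMap.coe_injective
    ((EuclideanSpace.basisFun (Fin (n k)) ℂ).toBasis.ext fun i => ?_)
  ext j
  simp [adjoint_projBlock_single, projBlock_apply]

theorem sum_adjoint_comp_projBlock :
    ∑ k, adjoint (projBlock n k) ∘L projBlock n k = 1 := by
  ext1 x
  refine ext_inner_right ℂ fun y => ?_
  simp only [_root_.sum_apply, sum_inner, comp_apply, adjoint_inner_left, one_apply_eq_self,
    PiLp.inner_apply, projBlock_apply]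
  rw [Fintype.sum_sigma]

theorem projBlock_comp_blockDiagonal' (Z : MatTuple n) (k : Fin N) :
    projBlock n k ∘L Matrix.toEuclideanCLM (n := Idx n) (𝕜 := ℂ) (Matrix.blockDiagonal' Z) =
      Matrix.toEuclideanCLM (n := Fin (n k)) (𝕜 := ℂ) (Z k) ∘L projBlock n k := by
  ext x i
  rw [comp_apply, comp_apply, projBlock_apply, Matrix.ofLp_toEuclideanCLM,
    Matrix.ofLp_toEuclideanCLM, Matrix.mulVec, Matrix.mulVec, dotProduct, dotProduct,
    Fintype.sum_sigma, Finset.sum_eq_single k]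
  · simp [projBlock_apply]
  · intro l _ hl
    refine Finset.sum_eq_zero fun j _ => ?_
    rw [Matrix.blockDiagonal'_apply_ne _ _ _ hl.symm, zero_mul]
  · simp

theorem toEuclideanCLM_conjTranspose {ι : Type*} [Fintype ι] [DecidableEq ι]
    (A : Matrix ι ι ℂ) :
    Matrix.toEuclideanCLM (n := ι) (𝕜 := ℂ) A.conjTranspose =
      adjoint (Matrix.toEuclideanCLM (n := ι) (𝕜 := ℂ) A) :=
  map_star (Matrix.toEuclideanCLM (n := ι) (𝕜 := ℂ)) A

theorem adjoint_projBlock_comp (Z : MatTuple n) (k : Fin N) :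
    Matrix.toEuclideanCLM (n := Idx n) (𝕜 := ℂ) (Matrix.blockDiagonal' Z) ∘L
        adjoint (projBlock n k) =
      adjoint (projBlock n k) ∘L Matrix.toEuclideanCLM (n := Fin (n k)) (𝕜 := ℂ) (Z k) := by
  have h := congrArg adjoint (projBlock_comp_blockDiagonal' (fun l => (Z l).conjTranspose) k)
  rw [adjoint_comp, adjoint_comp, ← Matrix.blockDiagonal'_conjTranspose,
    toEuclideanCLM_conjTranspose, toEuclideanCLM_conjTranspose, adjoint_adjoint, adjoint_adjoint] at h
  exact h

theorem sum_adjoint_comp_tensorId_comp (X : Type u) [NormedAddCommGroup X] [InnerProductSpace ℂ X]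
    [CompleteSpace X] (Z : MatTuple n) :
    ∑ k, adjoint ((projBlock n k).rTensor X) ∘L tensorId (Z k) X ∘L (projBlock n k).rTensor X =
      tensorId (Matrix.blockDiagonal' Z) X := by
  have h1 : Matrix.toEuclideanCLM (n := Idx n) (𝕜 := ℂ) (Matrix.blockDiagonal' Z) =
      ∑ k, adjoint (projBlock n k) ∘L
        Matrix.toEuclideanCLM (n := Fin (n k)) (𝕜 := ℂ) (Z k) ∘L projBlock n k := by
    simp only [← projBlock_comp_blockDiagonal', ← comp_assoc]
    rw [← finsetSum_comp, sum_adjoint_comp_projBlock]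
    rfl
  have h2 : ∀ (s : Finset (Fin N))
      (g : Fin N → EuclideanSpace ℂ (Idx n) →L[ℂ] EuclideanSpace ℂ (Idx n)),
      (∑ k ∈ s, g k).rTensor X = ∑ k ∈ s, (g k).rTensor X := fun s g => by
    classical
    induction s using Finset.induction_on with
    | empty => simp
    | insert a s ha ih => rw [Finset.sum_insert ha, Finset.sum_insert ha, rTensor_add, ih]
  rw [tensorId, h1, h2]
  refine Finset.sum_congr rfl fun k _ => ?_
  rw [rTensor_comp, rTensor_comp, adjoint_rTensor]
  rfl

end Coordinates

/-! ### Isometric embeddings into a common tensor product. -/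

section Embedding

variable {N : ℕ} (n : Fin N → ℕ) (M : Fin N → Type u)
    [∀ k, NormedAddCommGroup (M k)] [∀ k, InnerProductSpace ℂ (M k)]

/-- The embedding of `M_k` in the Hilbert space direct sum of the `M_k`. -/
def singleL (k : Fin N) : M k →L[ℂ] PiLp 2 M :=
  (PiLp.continuousLinearEquiv 2 ℂ M).symm.toContinuousLinearMap ∘L
    ContinuousLinearMap.single ℂ M k

theorem singleL_apply (k : Fin N) (x : M k) :
    singleL M k x = WithLp.toLp 2 (Pi.single k x) := rfl

/-- The embedding of `ℂ^{n_k} ⊗ M_k` in `ℂ^{n_1 + ⋯ + n_N} ⊗ (M_1 ⊕ ⋯ ⊕ M_N)`. -/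
def tensorEmbed (k : Fin N) : (EuclideanSpace ℂ (Fin (n k)) ⊗[ℂ] M k) →L[ℂ]
    (EuclideanSpace ℂ (Idx n) ⊗[ℂ] PiLp 2 M) :=
  TensorProduct.mapL (adjoint (projBlock n k)) (singleL M k)

theorem tensorId_comp_tensorEmbed (Z : MatTuple n) (k : Fin N) :
    tensorId (Matrix.blockDiagonal' Z) (PiLp 2 M) ∘L tensorEmbed n M k =
      tensorEmbed n M k ∘L tensorId (Z k) (M k) := by
  rw [tensorEmbed, tensorId, tensorId, rTensor_comp_mapL, mapL_comp_rTensor,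
    adjoint_projBlock_comp]

variable [∀ k, CompleteSpace (M k)]

theorem adjoint_singleL (k : Fin N) : adjoint (singleL M k) = PiLp.proj 2 M k := by
  symm
  rw [eq_adjoint_iff]
  intro x y
  rw [singleL_apply, PiLp.inner_apply, Finset.sum_eq_single k]
  · simp
  · intro l _ hl
    simp [Pi.single_eq_of_ne hl]
  · simp

theorem adjoint_singleL_comp_self (k : Fin N) :
    adjoint (singleL M k) ∘L singleL M k = 1 := by
  ext x
  simp [adjoint_singleL, singleL_apply]

theorem adjoint_singleL_comp_of_ne {k l : Fin N} (h : l ≠ k) :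
    adjoint (singleL M l) ∘L singleL M k = 0 := by
  ext x
  simp [adjoint_singleL, singleL_apply, Pi.single_eq_of_ne h]

theorem adjoint_tensorEmbed_comp_self (k : Fin N) :
    adjoint (tensorEmbed n M k) ∘L tensorEmbed n M k = 1 := by
  rw [tensorEmbed, TensorProduct.adjoint_mapL, ← TensorProduct.mapL_comp, adjoint_adjoint,
    projBlock_comp_adjoint, adjoint_singleL_comp_self]
  exact TensorProduct.mapL_id_id

theorem adjoint_tensorEmbed_comp_of_ne {k l : Fin N} (h : l ≠ k) :
    adjoint (tensorEmbed n M l) ∘L tensorEmbed n M k = 0 := by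
  rw [tensorEmbed, tensorEmbed, TensorProduct.adjoint_mapL, ← TensorProduct.mapL_comp,
    adjoint_singleL_comp_of_ne M h, TensorProduct.mapL_zero_right]

end Embedding

/-! ### Pencils written with a single operator `G`. -/

section Pencil

variable {N : ℕ} {n : Fin N → ℕ} {𝒰 H : Type u} {M : Fin N → Type u}
    [NormedAddCommGroup 𝒰] [InnerProductSpace ℂ 𝒰] [CompleteSpace 𝒰]
    [NormedAddCommGroup H] [InnerProductSpace ℂ H] [CompleteSpace H]
    [∀ k, NormedAddCommGroup (M k)] [∀ k, InnerProductSpace ℂ (M k)] [∀ k, CompleteSpace (M k)]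

/-- The embeddings are isometries with mutually orthogonal ranges that intertwine `Z_k ⊗ I` with the
block diagonal, so all cross terms vanish. -/
theorem pencil_eq_adjoint_sum_comp
    (G : ∀ k, WithLp 2 (𝒰 × H) →L[ℂ] (EuclideanSpace ℂ (Fin (n k)) ⊗[ℂ] M k)) (Z : MatTuple n) :
    pencil G Z = adjoint (∑ k, tensorEmbed n M k ∘L G k) ∘L
      tensorId (Matrix.blockDiagonal' Z) (PiLp 2 M) ∘L ∑ k, tensorEmbed n M k ∘L G k := by
  have h1 : tensorId (Matrix.blockDiagonal' Z) (PiLp 2 M) ∘L ∑ k, tensorEmbed n M k ∘L G k =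
      ∑ k, tensorEmbed n M k ∘L tensorId (Z k) (M k) ∘L G k := by
    rw [comp_finsetSum]
    refine Finset.sum_congr rfl fun k _ => ?_
    rw [← comp_assoc, tensorId_comp_tensorEmbed, comp_assoc]
  rw [h1, map_sum, finsetSum_comp, pencil]
  refine Finset.sum_congr rfl fun k _ => ?_
  rw [comp_finsetSum, Finset.sum_eq_single k]
  · rw [adjoint_comp, comp_assoc, ← comp_assoc _ (tensorEmbed n M k),
      adjoint_tensorEmbed_comp_self]
    rfl
  · intro l _ hl
    rw [adjoint_comp, comp_assoc, ← comp_assoc _ (tensorEmbed n M l),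
      adjoint_tensorEmbed_comp_of_ne n M hl.symm, zero_comp, comp_zero]
  · simp

/-- The opposite passage: a single `G` is cut into a family with every `M_k = X`. -/
theorem pencil_rTensor_comp {X : Type u} [NormedAddCommGroup X] [InnerProductSpace ℂ X]
    [CompleteSpace X] (G : WithLp 2 (𝒰 × H) →L[ℂ] (EuclideanSpace ℂ (Idx n) ⊗[ℂ] X))
    (Z : MatTuple n) :
    pencil (fun k => (projBlock n k).rTensor X ∘L G) Z =
      adjoint G ∘L tensorId (Matrix.blockDiagonal' Z) X ∘L G := by
  rw [← sum_adjoint_comp_tensorId_comp X Z, finsetSum_comp, comp_finsetSum, pencil]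
  refine Finset.sum_congr rfl fun k _ => ?_
  rw [adjoint_comp]
  simp only [comp_assoc]

/-- The pencil as a linear map of the matrix variables. -/
def pencilₗ (G : ∀ k, WithLp 2 (𝒰 × H) →L[ℂ] (EuclideanSpace ℂ (Fin (n k)) ⊗[ℂ] M k)) :
    MatTuple n →ₗ[ℂ] (WithLp 2 (𝒰 × H) →L[ℂ] WithLp 2 (𝒰 × H)) where
  toFun := pencil G
  map_add' Z Y := by
    simp only [pencil, Pi.add_apply, tensorId_add, add_comp, comp_add, Finset.sum_add_distrib]
  map_smul' c Z := by
    simp only [pencil, Pi.smul_apply, tensorId_smul, smul_comp, comp_smul, Finset.smul_sum,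
      RingHom.id_apply]

theorem re_inner_pencil_nonneg
    (G : ∀ k, WithLp 2 (𝒰 × H) →L[ℂ] (EuclideanSpace ℂ (Fin (n k)) ⊗[ℂ] M k)) {Z : MatTuple n}
    (hZ : Z ∈ halfplane n) (x : WithLp 2 (𝒰 × H)) : 0 ≤ (inner ℂ (pencil G Z x) x).re := by
  rw [pencil, _root_.sum_apply, sum_inner, Complex.re_sum]
  refine Finset.sum_nonneg fun k _ => ?_
  rw [comp_apply, comp_apply, adjoint_inner_left]
  obtain ⟨δ, hδ, h⟩ := exists_pos_le_re_inner_tensorId_of_add (M k) (hZ k)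
  exact le_trans (by positivity) (h _)

end Pencil

end Bessmertnyi

end

noncomputable section

namespace Bessmertnyi

open ContinuousLinearMap

/-! ### Holomorphy of Schur complements. -/

section Holomorphy

variable {E F V : Type*} [NormedAddCommGroup E] [InnerProductSpace ℂ E]
  [NormedAddCommGroup F] [InnerProductSpace ℂ F] [CompleteSpace F] [NormedAddCommGroup V] [NormedSpace ℂ V]
  [FiniteDimensional ℂ V]

theorem differentiableOn_schur_linearMap
    (L : V →ₗ[ℂ] (WithLp 2 (E × F) →L[ℂ] WithLp 2 (E × F))) {s : Set V}
    (hs : ∀ z ∈ s, IsUnit (block22 (L z))) : DifferentiableOn ℂ (fun z => schur (L z)) s := by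
  have hL : Differentiable ℂ L := (LinearMap.toContinuousLinearMap L).differentiable
  have h11 : Differentiable ℂ fun z => block11 (L z) := by
    unfold block11; fun_prop
  have h12 : Differentiable ℂ fun z => block12 (L z) := by
    unfold block12; fun_prop
  have h21 : Differentiable ℂ fun z => block21 (L z) := by
    unfold block21; fun_prop
  have h22 : Differentiable ℂ fun z => block22 (L z) := by
    unfold block22; fun_prop
  intro z hz
  have hinv : DifferentiableAt ℂ (fun z => Ring.inverse (block22 (L z))) z :=
    DifferentiableAt.comp (g := Ring.inverse) z (differentiableAt_inverse (hs z hz)) (h22 z)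
  exact ((h11 z).sub ((h12 z).clm_comp (hinv.clm_comp (h21 z)))).differentiableWithinAt

end Holomorphy

section MatTuple

-- An auxiliary norm, used to apply the normed-space lemma; the differentiability asserted concerns
-- the entrywise topology.
attribute [local instance] Matrix.normedAddCommGroup Matrix.normedSpace

theorem differentiableOn_schur_pencil {N : ℕ} {n : Fin N → ℕ} {𝒰 H : Type u} {M : Fin N → Type u}
    [NormedAddCommGroup 𝒰] [InnerProductSpace ℂ 𝒰] [CompleteSpace 𝒰]
    [NormedAddCommGroup H] [InnerProductSpace ℂ H] [CompleteSpace H]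
    [∀ k, NormedAddCommGroup (M k)] [∀ k, InnerProductSpace ℂ (M k)] [∀ k, CompleteSpace (M k)]
    (G : ∀ k, WithLp 2 (𝒰 × H) →L[ℂ] (EuclideanSpace ℂ (Fin (n k)) ⊗[ℂ] M k))
    {s : Set (MatTuple n)} (hs : ∀ Z ∈ s, IsUnit (block22 (pencil G Z))) :
    DifferentiableOn ℂ (fun Z => schur (pencil G Z)) s :=
  differentiableOn_schur_linearMap (pencilₗ G) hs

end MatTuple

/-! ### The two directions of the characterization. -/

section Main

variable {N : ℕ} {n : Fin N → ℕ} {𝒰 : Type u}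
    [NormedAddCommGroup 𝒰] [InnerProductSpace ℂ 𝒰] [CompleteSpace 𝒰]

theorem isUnit_add_one_of_mem_bessmertnyiClass {f : MatTuple n → 𝒰 →L[ℂ] 𝒰}
    (hf : f ∈ bessmertnyiClass n 𝒰) {Z : MatTuple n} (hZ : Z ∈ halfplane n) :
    IsUnit (f Z + 1) := by
  obtain ⟨-, M, _, _, _, H, _, _, _, G, hG⟩ := hf
  obtain ⟨hd, hfZ⟩ := hG Z (halfplane_subset_omega hZ)
  rw [hfZ]
  exact isUnit_schur_add_one hd (re_inner_pencil_nonneg G hZ)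

theorem tensorId_cayley (X : Type u) [NormedAddCommGroup X] [InnerProductSpace ℂ X]
    {W : MatTuple n} (hW : W ∈ disk n) :
    tensorId (Matrix.blockDiagonal' (cayley W)) X -
      tensorId (Matrix.blockDiagonal' W) X * tensorId (Matrix.blockDiagonal' (cayley W)) X =
      1 + tensorId (Matrix.blockDiagonal' W) X := by
  rw [← tensorId_mul, ← tensorId_sub, blockDiagonal'_cayley hW, tensorId_add, tensorId_one]

theorem exists_isRealizedBy_of_mem_bessmertnyiClass {f F : MatTuple n → 𝒰 →L[ℂ] 𝒰}
    (hf : f ∈ bessmertnyiClass n 𝒰) (hF : ∀ W ∈ disk n, F W = doubleCayley f W) :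
    ∃ (X : Type u) (_ : NormedAddCommGroup X) (_ : InnerProductSpace ℂ X) (_ : CompleteSpace X)
      (T : WithLp 2 ((EuclideanSpace ℂ (Idx n) ⊗[ℂ] X) × 𝒰) →L[ℂ]
        WithLp 2 ((EuclideanSpace ℂ (Idx n) ⊗[ℂ] X) × 𝒰)),
      adjoint T = T ∧ T * T = 1 ∧ IsRealizedBy F T := by
  have hunit := fun W (hW : W ∈ disk n) =>
    isUnit_add_one_of_mem_bessmertnyiClass hf (cayley_mem_halfplane hW)
  obtain ⟨-, M, _, _, _, H, _, _, _, G, hG⟩ := hf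
  obtain ⟨T, hT, hTT, hneg, hpos, hnorm⟩ :=
    exists_reflection_graphOp (∑ k, tensorEmbed n M k ∘L G k)
  refine ⟨PiLp 2 M, inferInstance, inferInstance, inferInstance, T, hT, hTT, fun W hW => ?_⟩
  -- Neumann series: `A` is a contraction because `T` is isometric, and `‖P(W) ⊗ I‖ < 1`.
  have hA : IsUnit (1 - block11 T ∘L tensorId (Matrix.blockDiagonal' W) (PiLp 2 M)) := by
    refine isUnit_one_sub_of_norm_lt_one
      (x := block11 T ∘L tensorId (Matrix.blockDiagonal' W) (PiLp 2 M)) ?_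
    refine (opNorm_comp_le _ _).trans_lt ?_
    refine (mul_le_of_le_one_left (norm_nonneg _)
      (norm_block11_le T zero_le_one fun x => ?_)).trans_lt
        (norm_tensorId_lt_one _ (posDef_one_sub_blockDiagonal' hW))
    rw [hnorm, one_mul]
  refine ⟨hA, ?_⟩
  obtain ⟨hd, hfZ⟩ := hG (cayley W) (halfplane_subset_omega (cayley_mem_halfplane hW))
  have hu := hunit W hW
  rw [hF W hW, doubleCayley]
  change f (cayley W) = schur (pencil G (cayley W)) at hfZ
  rw [hfZ] at hu ⊢
  rw [pencil_eq_adjoint_sum_comp] at hu hd ⊢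
  exact (transfer_eq_cayley_schur hneg hpos (tensorId_cayley _ hW) hA hd hu).symm

theorem one_notMem_spectrum_of_doubleCayley {f F : MatTuple n → 𝒰 →L[ℂ] 𝒰}
    (hf : f ∈ bessmertnyiClass n 𝒰) (hF : ∀ W ∈ disk n, F W = doubleCayley f W) :
    (1 : ℂ) ∉ spectrum ℂ (F 0) := by
  have hu := isUnit_add_one_of_mem_bessmertnyiClass hf (cayley_mem_halfplane zero_mem_disk)
  rw [spectrum.notMem_iff, map_one, hF 0 zero_mem_disk, doubleCayley]
  set g := f (cayley 0)
  -- Hence `1 - F(0)` is twice an inverse, which gives (ii).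
  have h : 1 - (g - 1) * Ring.inverse (g + 1) = (2 : ℂ) • Ring.inverse (g + 1) := by
    nth_rewrite 1 [← Ring.mul_inverse_cancel _ hu]
    rw [← sub_mul, two_smul, ← two_mul]
    congr 1
    rw [show g + 1 - (g - 1) = 1 + 1 by abel, one_add_one_eq_two]
  rw [h]
  exact (hu.ringInverse).smul (Units.mk0 (2 : ℂ) two_ne_zero)

/-- As `G` is isometric on `H`, `d(Z)` inherits the coercivity constant of `Z ⊗ I`. -/
theorem isUnit_block22_pencil_rTensor_comp {X H : Type u} [NormedAddCommGroup X]
    [InnerProductSpace ℂ X] [CompleteSpace X] [NormedAddCommGroup H] [InnerProductSpace ℂ H]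
    [CompleteSpace H] {G : WithLp 2 (𝒰 × H) →L[ℂ] (EuclideanSpace ℂ (Idx n) ⊗[ℂ] X)}
    (hG : ∀ h, ‖G (inrL 𝒰 H h)‖ = ‖h‖) {Z : MatTuple n} (hZ : Z ∈ halfplane n) :
    IsUnit (block22 (pencil (fun k => (projBlock n k).rTensor X ∘L G) Z)) := by
  obtain ⟨δ, hδ, h⟩ := exists_pos_le_re_inner_tensorId_of_add X (posDef_blockDiagonal'_add hZ)
  refine isUnit_of_le_re_inner _ hδ fun x => ?_
  rw [pencil_rTensor_comp]
  set S := adjoint G ∘L tensorId (Matrix.blockDiagonal' Z) X ∘L G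
  have h1 : inner ℂ (block22 S x) x = inner ℂ (S (inrL 𝒰 H x)) (inrL 𝒰 H x) := by
    rw [WithLp.prod_inner_apply]
    change _ = inner ℂ _ (0 : 𝒰) + inner ℂ _ x
    rw [inner_zero_right, zero_add]
    rfl
  rw [h1, comp_apply, comp_apply, adjoint_inner_left, ← hG]
  exact h _

/-- The pencil is homogeneous of degree one, so rotating the halfplane only multiplies `d` by a
nonzero scalar. -/
theorem isUnit_block22_pencil_of_mem_omega {H : Type u} {M : Fin N → Type u}
    [NormedAddCommGroup H] [InnerProductSpace ℂ H] [CompleteSpace H]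
    [∀ k, NormedAddCommGroup (M k)] [∀ k, InnerProductSpace ℂ (M k)] [∀ k, CompleteSpace (M k)]
    {G : ∀ k, WithLp 2 (𝒰 × H) →L[ℂ] (EuclideanSpace ℂ (Fin (n k)) ⊗[ℂ] M k)}
    (hG : ∀ Z ∈ halfplane n, IsUnit (block22 (pencil G Z))) {Z : MatTuple n} (hZ : Z ∈ omega n) :
    IsUnit (block22 (pencil G Z)) := by
  obtain ⟨l, hl, Y, hY, rfl⟩ := hZ
  have hl0 : l ≠ 0 := by
    rintro rfl
    simp at hl
  have h1 : block22 (pencil G (l • Y)) = l • block22 (pencil G Y) := by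
    rw [show pencil G (l • Y) = l • pencil G Y from (pencilₗ G).map_smul l Y, block22, block22,
      smul_comp, comp_smul]
  rw [h1]
  exact (hG Y hY).smul (Units.mk0 l hl0)

theorem schur_pencil_mem_bessmertnyiClass {H : Type u} {M : Fin N → Type u}
    [NormedAddCommGroup H] [InnerProductSpace ℂ H] [CompleteSpace H]
    [∀ k, NormedAddCommGroup (M k)] [∀ k, InnerProductSpace ℂ (M k)] [∀ k, CompleteSpace (M k)]
    {G : ∀ k, WithLp 2 (𝒰 × H) →L[ℂ] (EuclideanSpace ℂ (Fin (n k)) ⊗[ℂ] M k)}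
    (hG : ∀ Z ∈ halfplane n, IsUnit (block22 (pencil G Z))) :
    (fun Z => schur (pencil G Z)) ∈ bessmertnyiClass n 𝒰 :=
  ⟨differentiableOn_schur_pencil G fun _ => isUnit_block22_pencil_of_mem_omega hG,
    M, inferInstance, inferInstance, inferInstance, H, inferInstance, inferInstance,
    inferInstance, G, fun _ hZ => ⟨isUnit_block22_pencil_of_mem_omega hG hZ, rfl⟩⟩

theorem exists_mem_bessmertnyiClass_of_isRealizedBy {F : MatTuple n → 𝒰 →L[ℂ] 𝒰}
    {X : Type u} [NormedAddCommGroup X] [InnerProductSpace ℂ X] [CompleteSpace X]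
    {T : WithLp 2 ((EuclideanSpace ℂ (Idx n) ⊗[ℂ] X) × 𝒰) →L[ℂ]
      WithLp 2 ((EuclideanSpace ℂ (Idx n) ⊗[ℂ] X) × 𝒰)}
    (hT : adjoint T = T) (hTT : T * T = 1) (hFT : IsRealizedBy F T)
    (hF0 : (1 : ℂ) ∉ spectrum ℂ (F 0)) :
    ∃ f ∈ bessmertnyiClass n 𝒰, ∀ W ∈ disk n, F W = doubleCayley f W := by
  -- At `W = 0` the realization reduces to `F(0) = D`.
  have hD : IsUnit (1 - block22 T) := by
    have h0 := (hFT 0 zero_mem_disk).2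
    rw [Matrix.blockDiagonal'_zero, tensorId_zero, zero_comp, comp_zero, add_zero] at h0
    rwa [spectrum.notMem_iff, map_one, h0] at hF0
  obtain ⟨H, _, _, _, G, hG, hneg, hpos⟩ := exists_graphOp_eigenspace hT hTT hD
  have hmem := schur_pencil_mem_bessmertnyiClass
    (G := fun k => (projBlock n k).rTensor X ∘L G)
    fun _ => isUnit_block22_pencil_rTensor_comp hG
  refine ⟨_, hmem, fun W hW => ?_⟩
  obtain ⟨hA, hFW⟩ := hFT W hW
  have hZ := cayley_mem_halfplane hW
  have hu := isUnit_add_one_of_mem_bessmertnyiClass hmem hZ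
  have hd := isUnit_block22_pencil_rTensor_comp hG hZ
  rw [hFW, doubleCayley]
  simp only [pencil_rTensor_comp] at hu hd ⊢
  exact transfer_eq_cayley_schur hneg hpos (tensorId_cayley X hW) hA hd hu

end Main

end Bessmertnyi

end

/-- The double Cayley transform is well defined on the Bessmertnyĭ class (first conjunct), and its
image is characterized by a realization with a self-adjoint unitary colligation together with
`1 ∉ σ(F(0))` (second conjunct). -/
theorem mainTheorem2 {N : ℕ} (n : Fin N → ℕ) (𝒰 : Type u)
    [NormedAddCommGroup 𝒰] [InnerProductSpace ℂ 𝒰] [CompleteSpace 𝒰]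
    (F : Bessmertnyi.MatTuple n → 𝒰 →L[ℂ] 𝒰)
    (hF : DifferentiableOn ℂ F (Bessmertnyi.disk n)) :
    (∀ f ∈ Bessmertnyi.bessmertnyiClass n 𝒰, ∀ W ∈ Bessmertnyi.disk n,
      IsUnit (f (Bessmertnyi.cayley W) + 1)) ∧
    ((∃ f ∈ Bessmertnyi.bessmertnyiClass n 𝒰,
        ∀ W ∈ Bessmertnyi.disk n, F W = Bessmertnyi.doubleCayley f W) ↔
      (∃ (X : Type u) (_ : NormedAddCommGroup X) (_ : InnerProductSpace ℂ X)
          (_ : CompleteSpace X)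
          (T : WithLp 2 ((EuclideanSpace ℂ (Bessmertnyi.Idx n) ⊗[ℂ] X) × 𝒰) →L[ℂ]
            WithLp 2 ((EuclideanSpace ℂ (Bessmertnyi.Idx n) ⊗[ℂ] X) × 𝒰)),
          ContinuousLinearMap.adjoint T = T ∧ T * T = 1 ∧ Bessmertnyi.IsRealizedBy F T) ∧
      (1 : ℂ) ∉ spectrum ℂ (F 0)) := by
  refine ⟨fun f hf W hW => Bessmertnyi.isUnit_add_one_of_mem_bessmertnyiClass hf
    (Bessmertnyi.cayley_mem_halfplane hW), ?_, ?_⟩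
  · rintro ⟨f, hf, hFf⟩
    exact ⟨Bessmertnyi.exists_isRealizedBy_of_mem_bessmertnyiClass hf hFf,
      Bessmertnyi.one_notMem_spectrum_of_doubleCayley hf hFf⟩
  · rintro ⟨⟨X, _, _, _, T, hT, hTT, hFT⟩, hF0⟩
    exact Bessmertnyi.exists_mem_bessmertnyiClass_of_isRealizedBy hT hTT hFT hF0
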